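/- Let $\Theta\subset\mathbb R^m$, let $P_0$ be a probability measure on a measurable space $\Xi$, and let $h:\Theta\times\Xi\to\mathbb R$. Let $\xi_1,\xi_2,\dots$ be i.i.d. $\Xi$-valued random variables with law $P_0$, defined on a probability space with probability $P$, and let $0<\alpha<1$. Fix $x\in\Theta$, and assume that $h(x;\cdot)$ is $P_0$-integrable, with mean $Z_0(x)=E_0[h(x;\xi)]$, and that $0<\mathrm{Var}_0(h(x;\xi))<\infty$, where $E_0$ and $\mathrm{Var}_0$ denote expectation and variance under $P_0$. Let $\chi^2_{1,1-\alpha}$ be the $(1-\alpha)$-quantile of the $\chi^2$-distribution with one degree of freedom and, for $n\ge1$ and $\eta>0$, let $$\mathcal U_n(\eta)=\Big\{\mathbf w\in\mathbb R^n:\ -\frac1n\sum_{i=1}^n\log(nw_i)\le\eta,\ \sum_{i=1}^nw_i=1,\ w_i\ge0\text{ for all }i\Big\}$$ be the empirical Burg-entropy divergence ball (with $\log 0=-\infty$). Then, for every $n\ge1$ and every sample, the minimum and the maximum $$\underline Z_n(x)=\min_{\mathbf w\in\mathcal U_n(\chi^2_{1,1-\alpha}/(2n))}\sum_{i=1}^nh(x;\xi_i)w_i,\qquad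 \overline Z_n(x)=\max_{\mathbf w\in\mathcal U_n(\chi^2_{1,1-\alpha}/(2n))}\sum_{i=1}^nh(x;\xi_i)w_i$$ exist, and $$\lim_{n\to\infty}P\big(\underline Z_n(x)\le Z_0(x)\le\overline Z_n(x)\big)=1-\alpha.$$ -/

import Mathlib

open MeasureTheory ProbabilityTheory Filter Topology

/-- The `χ²` distribution with one degree of freedom: the law of the square of a standard
normal random variable. -/
noncomputable def chiSquareOne : Measure ℝ :=
  (gaussianReal 0 1).map (fun z => z ^ 2)

/-- The `p`-quantile of a probability distribution `μ` on `ℝ`, for `0 < p < 1`: the least `t`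
with `μ (-∞, t] ≥ p`. -/
noncomputable def quantile (μ : Measure ℝ) (p : ℝ) : ℝ :=
  sInf {t : ℝ | p ≤ cdf μ t}

/-- The empirical Burg-entropy divergence ball of radius `η`: all probability weight vectors
`w` on `n` data points with `-(1/n) ∑ log (n wᵢ) ≤ η`. The logarithm is the extended-real-valued
one with `log 0 = -∞`, so a vector with a vanishing weight is never in the ball. -/
def burgBall (n : ℕ) (η : ℝ) : Set (Fin n → ℝ) :=
  {w | -(((1 / (n : ℝ) : ℝ) : EReal) * ∑ i, ENNReal.log (ENNReal.ofReal ((n : ℝ) * w i)))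
          ≤ (η : EReal)
      ∧ ∑ i, w i = 1 ∧ ∀ i, 0 ≤ w i}

/-- The set of objective values `∑ yᵢ wᵢ`, with `w` ranging over the Burg-entropy ball. -/
def objectiveValues {n : ℕ} (η : ℝ) (y : Fin n → ℝ) : Set ℝ :=
  (fun w : Fin n → ℝ => ∑ i, y i * w i) '' burgBall n η

/-- The optimal value of the minimization of `∑ yᵢ wᵢ` over the Burg-entropy ball. -/
noncomputable def minValue {n : ℕ} (η : ℝ) (y : Fin n → ℝ) : ℝ :=
  sInf (objectiveValues η y)

/-- The optimal value of the maximization of `∑ yᵢ wᵢ` over the Burg-entropy ball. -/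
noncomputable def maxValue {n : ℕ} (η : ℝ) (y : Fin n → ℝ) : ℝ :=
  sSup (objectiveValues η y)

/-- The radius `χ²_{1,1-α} / (2n)`. -/
noncomputable def burgRadius (α : ℝ) (n : ℕ) : ℝ :=
  quantile chiSquareOne (1 - α) / (2 * (n : ℝ))

/-! After standardizing, the mean is covered exactly when one weight vector in the ball makes the
weighted sum `≤ 0` and another makes it `≥ 0`. Let `T` be the normalized sum and `q` the quantile.
Off a bad event, coverage is sandwiched between two events `T ^ 2 ≤ r` with `r` close to `q`.
Coverage forces `T ^ 2 ≤ q * (1 + 5 * ε) ^ 2` by weak duality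
(`sq_normalized_sum_le_of_mem_burgBall`); conversely, a slightly smaller `T ^ 2` allows explicit
weights with weighted sum zero (`exists_mem_burgBall_sum_eq_zero`). The strong law makes the bad
event negligible, the CLT gives the limit for each `r`, and continuity of the `χ²` cdf lets `ε → 0`.
-/

/-! ### The Burg-entropy ball in product form, and attained optima. -/

theorem mem_burgBall_iff {n : ℕ} (hn : 1 ≤ n) {η : ℝ} {w : Fin n → ℝ} :
    w ∈ burgBall n η ↔
      Real.exp (-(n * η)) ≤ ∏ i, (n * w i) ∧ ∑ i, w i = 1 ∧ ∀ i, 0 ≤ w i := by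
  have hn' : (0 : ℝ) < n := by exact_mod_cast hn
  simp only [burgBall, Set.mem_ofPred_eq]
  refine and_congr_left fun ⟨_, hw⟩ => ?_
  have hsum : ∀ s : Finset (Fin n), ∑ i ∈ s, ENNReal.log (ENNReal.ofReal (n * w i))
      = ENNReal.log (ENNReal.ofReal (∏ i ∈ s, (n * w i))) := by
    intro s
    induction s using Finset.induction_on with
    | empty => simp
    | insert a s ha ih =>
      rw [Finset.sum_insert ha, Finset.prod_insert ha,
        ENNReal.ofReal_mul (mul_nonneg hn'.le (hw a)), ENNReal.log_mul_add, ih]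
  rw [hsum]
  rcases (Finset.prod_nonneg fun i (_ : i ∈ Finset.univ) => mul_nonneg hn'.le (hw i)).eq_or_lt
    with h0 | h0
  -- If the product vanishes, the log-sum is `⊥` and both sides are false.
  · rw [← h0, ENNReal.ofReal_zero, ENNReal.log_zero, EReal.coe_mul_bot_of_pos (by positivity)]
    simp [Real.exp_pos]
  · rw [ENNReal.log_ofReal_of_pos h0, ← EReal.coe_mul, ← EReal.coe_neg, EReal.coe_le_coe_iff,
      ← Real.le_log_iff_exp_le h0, one_div, ← neg_le_neg_iff, neg_neg, ← div_eq_inv_mul,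
      le_div_iff₀ hn']
    constructor <;> intro h <;> linarith

theorem uniform_mem_burgBall {n : ℕ} (hn : 1 ≤ n) {η : ℝ} (hη : 0 ≤ η) :
    (fun _ => (n : ℝ)⁻¹) ∈ burgBall n η := by
  have hn' : (n : ℝ) ≠ 0 := by positivity
  rw [mem_burgBall_iff hn]
  refine ⟨?_, by simp [hn'], fun _ => by positivity⟩
  simp only [mul_inv_cancel₀ hn', Finset.prod_const_one, Real.exp_le_one_iff, neg_nonpos]
  positivity

/-- In product form the entropy constraint is a closed polynomial condition on the simplex. -/
theorem isCompact_burgBall {n : ℕ} (hn : 1 ≤ n) (η : ℝ) : IsCompact (burgBall n η) := by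
  have hset : burgBall n η = {w | Real.exp (-(n * η)) ≤ ∏ i, ((n : ℝ) * w i)} ∩ stdSimplex ℝ (Fin n) := by
    ext w
    rw [mem_burgBall_iff hn]
    simp only [stdSimplex, Set.mem_inter_iff, Set.mem_ofPred_eq]
    tauto
  rw [hset]
  refine (isCompact_stdSimplex ℝ (Fin n)).inter_left ?_
  exact isClosed_le continuous_const (by fun_prop)

theorem isCompact_objectiveValues {n : ℕ} (hn : 1 ≤ n) (η : ℝ) (y : Fin n → ℝ) :
    IsCompact (objectiveValues η y) :=
  (isCompact_burgBall hn η).image (by fun_prop)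

theorem objectiveValues_nonempty {n : ℕ} (hn : 1 ≤ n) {η : ℝ} (hη : 0 ≤ η) (y : Fin n → ℝ) :
    (objectiveValues η y).Nonempty :=
  ⟨_, _, uniform_mem_burgBall hn hη, rfl⟩

theorem isLeast_minValue {n : ℕ} (hn : 1 ≤ n) {η : ℝ} (hη : 0 ≤ η) (y : Fin n → ℝ) :
    IsLeast (objectiveValues η y) (minValue η y) :=
  (isCompact_objectiveValues hn η y).isLeast_sInf (objectiveValues_nonempty hn hη y)

theorem isGreatest_maxValue {n : ℕ} (hn : 1 ≤ n) {η : ℝ} (hη : 0 ≤ η) (y : Fin n → ℝ) :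
    IsGreatest (objectiveValues η y) (maxValue η y) :=
  (isCompact_objectiveValues hn η y).isGreatest_sSup (objectiveValues_nonempty hn hη y)

/-! ### Deterministic bounds relating the ball to the normalized sum. -/

/-- Second-order Taylor expansion; the cubic remainder is at most `2 * ε * u ^ 2`. -/
theorem le_log_one_add_of_abs_le {u ε : ℝ} (hu : |u| ≤ ε) (hε : ε ≤ 1 / 2) :
    u - (1 + 4 * ε) / 2 * u ^ 2 ≤ Real.log (1 + u) := by
  have h1 : |(-u)| < 1 := by rw [abs_neg]; linarith
  have h := Real.abs_log_sub_add_sum_range_le h1 2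
  rw [abs_neg] at h
  have hb : |u| ^ (2 + 1) / (1 - |u|) ≤ 2 * ε * u ^ 2 := by
    rw [abs_neg] at h1
    rw [div_le_iff₀ (by linarith), pow_succ, sq_abs]
    nlinarith [mul_nonneg (sq_nonneg u) (sub_nonneg.2 hu), abs_nonneg u,
      mul_nonneg (mul_nonneg (sq_nonneg u) ((abs_nonneg u).trans hu))
        (by linarith : (0 : ℝ) ≤ 1 / 2 - |u|)]
  have h2 := (abs_le.1 (h.trans hb)).1
  simp only [Finset.sum_range_succ, Finset.sum_range_zero] at h2
  norm_num [sub_neg_eq_add] at h2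
  linarith

/-- Weak duality for the Burg-entropy ball. -/
theorem sum_log_le_of_mem_burgBall {n : ℕ} (hn : 1 ≤ n) {η : ℝ} {w u : Fin n → ℝ}
    (hw : w ∈ burgBall n η) (hu : ∀ i, 0 < 1 + u i) (hwu : ∑ i, u i * w i ≤ 0) :
    ∑ i, Real.log (1 + u i) ≤ n * η := by
  have hn' : (0 : ℝ) < n := by exact_mod_cast hn
  obtain ⟨hprod, hsum, hpos⟩ := (mem_burgBall_iff hn).1 hw
  have hprod_pos := (Real.exp_pos _).trans_le hprod
  have hne : ∀ i, (n : ℝ) * w i ≠ 0 := fun i hi =>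
    hprod_pos.ne' (Finset.prod_eq_zero (Finset.mem_univ i) hi)
  have hnw : ∀ i, 0 < (n : ℝ) * w i := fun i =>
    lt_of_le_of_ne (mul_nonneg hn'.le (hpos i)) (hne i).symm
  have hlog : -(n * η) ≤ ∑ i, Real.log (n * w i) := by
    rw [← Real.log_prod fun i _ => hne i]
    exact (Real.le_log_iff_exp_le hprod_pos).2 hprod
  -- Apply `log t ≤ t - 1` at `t = n * w i * (1 + u i)`.
  have hle : ∑ i, (Real.log (n * w i) + Real.log (1 + u i)) ≤ 0 := by
    calc ∑ i, (Real.log (n * w i) + Real.log (1 + u i))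
        ≤ ∑ i, (n * (w i + u i * w i) - 1) := by
          refine Finset.sum_le_sum fun i _ => ?_
          rw [← Real.log_mul (hne i) (hu i).ne']
          have := Real.log_le_sub_one_of_pos (mul_pos (hnw i) (hu i))
          linarith
      _ = n * (1 + ∑ i, u i * w i) - n := by
          rw [Finset.sum_sub_distrib, ← Finset.mul_sum, Finset.sum_add_distrib, hsum]
          simp
      _ ≤ 0 := by nlinarith
  rw [Finset.sum_add_distrib] at hle
  linarith

/-- Weak duality with `u i = a * y i / √n` gives roughly `a * T - a ^ 2 / 2 ≤ q / 2`. The resulting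
bound on `|T|` is sharpest at `a ^ 2 = q`; the sign of `a` selects the side. -/
theorem const_mul_sum_le_of_mem_burgBall {n : ℕ} (hn : 1 ≤ n) {q ε a : ℝ} (hq : 0 < q)
    (hε : 0 < ε) (hε' : ε ≤ 1 / 2) (ha : a ^ 2 = q) {y w : Fin n → ℝ}
    (hmax : ∀ i, q * y i ^ 2 ≤ ε ^ 2 * n) (hS : (∑ i, y i ^ 2) / n ≤ 1 + ε)
    (hw : w ∈ burgBall n (q / (2 * n))) (hwy : a * ∑ i, y i * w i ≤ 0) :
    a * ((√n)⁻¹ * ∑ i, y i) ≤ q * (1 + 5 * ε) := by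
  have hn' : (0 : ℝ) < n := by exact_mod_cast hn
  have hs : 0 < √(n : ℝ) := Real.sqrt_pos.2 hn'
  have hs2 : √(n : ℝ) ^ 2 = n := Real.sq_sqrt hn'.le
  set c := a * (√n)⁻¹ with hc
  have hc2 : c ^ 2 = q / n := by rw [hc, mul_pow, ha, inv_pow, hs2]; rfl
  have hu : ∀ i, |c * y i| ≤ ε := fun i => by
    refine abs_le_of_sq_le_sq ?_ hε.le
    rw [mul_pow, hc2, div_mul_eq_mul_div, div_le_iff₀ hn']
    exact hmax i
  have hdual := sum_log_le_of_mem_burgBall hn (u := fun i => c * y i) hw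
    (fun i => by have := (abs_le.1 (hu i)).1; linarith)
    (by
      have : ∑ i, c * y i * w i = (√n)⁻¹ * (a * ∑ i, y i * w i) := by
        rw [Finset.mul_sum, Finset.mul_sum]
        exact Finset.sum_congr rfl fun i _ => by rw [hc]; ring
      rw [this]
      exact mul_nonpos_of_nonneg_of_nonpos (by positivity) hwy)
  have hlow : c * ∑ i, y i - (1 + 4 * ε) / 2 * (q * ((∑ i, y i ^ 2) / n))
      ≤ ∑ i, Real.log (1 + c * y i) := by
    have : c * ∑ i, y i - (1 + 4 * ε) / 2 * (q * ((∑ i, y i ^ 2) / n))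
        = ∑ i, (c * y i - (1 + 4 * ε) / 2 * (c * y i) ^ 2) := by
      simp only [mul_pow, hc2]
      rw [Finset.sum_sub_distrib, ← Finset.mul_sum, ← Finset.mul_sum, ← Finset.mul_sum]
      ring
    rw [this]
    exact Finset.sum_le_sum fun i _ => le_log_one_add_of_abs_le (hu i) hε'
  have hη : (n : ℝ) * (q / (2 * n)) = q / 2 := by field_simp
  rw [hη] at hdual
  have hSq : q * ((∑ i, y i ^ 2) / n) ≤ q * (1 + ε) := by gcongr
  have hmul : (1 + 4 * ε) / 2 * (q * ((∑ i, y i ^ 2) / n)) ≤ (1 + 4 * ε) / 2 * (q * (1 + ε)) := by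
    gcongr
  have hfin : (1 + 4 * ε) / 2 * (q * (1 + ε)) + q / 2 ≤ q * (1 + 5 * ε) := by
    nlinarith [mul_nonneg (mul_nonneg hq.le hε.le) (by linarith : (0 : ℝ) ≤ 1 / 2 - ε),
      mul_pos hq hε]
  calc a * ((√n)⁻¹ * ∑ i, y i) = c * ∑ i, y i := by rw [hc]; ring
    _ ≤ q * (1 + 5 * ε) := by linarith

theorem sq_normalized_sum_le_of_mem_burgBall {n : ℕ} (hn : 1 ≤ n) {q ε : ℝ} (hq : 0 < q)
    (hε : 0 < ε) (hε' : ε ≤ 1 / 2) {y : Fin n → ℝ}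
    (hmax : ∀ i, q * y i ^ 2 ≤ ε ^ 2 * n) (hS : (∑ i, y i ^ 2) / n ≤ 1 + ε)
    (h₁ : ∃ w ∈ burgBall n (q / (2 * n)), ∑ i, y i * w i ≤ 0)
    (h₂ : ∃ w ∈ burgBall n (q / (2 * n)), 0 ≤ ∑ i, y i * w i) :
    ((√n)⁻¹ * ∑ i, y i) ^ 2 ≤ q * (1 + 5 * ε) ^ 2 := by
  obtain ⟨w₁, hw₁, h₁⟩ := h₁
  obtain ⟨w₂, hw₂, h₂⟩ := h₂
  have hsq : √q ^ 2 = q := Real.sq_sqrt hq.le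
  have hspos : 0 < √q := Real.sqrt_pos.2 hq
  have h1 := const_mul_sum_le_of_mem_burgBall hn hq hε hε' hsq hmax hS hw₁
    (mul_nonpos_of_nonneg_of_nonpos hspos.le h₁)
  have h2 := const_mul_sum_le_of_mem_burgBall hn hq hε hε' (a := -√q) (by rw [neg_sq, hsq]) hmax hS
    hw₂ (mul_nonpos_of_nonpos_of_nonneg (by linarith) h₂)
  generalize (√n)⁻¹ * ∑ i, y i = T at h1 h2 ⊢
  have h3 : (√q * T) ^ 2 ≤ (q * (1 + 5 * ε)) ^ 2 :=
    sq_le_sq' (by linarith) h1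
  rw [mul_pow, hsq, mul_pow, sq q, mul_assoc] at h3
  exact le_of_mul_le_mul_left h3 hq

/-- With `m` and `V` the sample mean and variance, tilt the uniform weights by the factor `1 - m / V
* (y i - m)`. This cancels the mean exactly, and its log-cost is about `n * m ^ 2 / (2 * V) = T ^ 2
/ (2 * V)`. The factor `1 - 2 * ε` bounds `V` below; `1 + 16 * ε` is the Taylor loss for a tilt of
size `4 * ε`. -/
theorem exists_mem_burgBall_sum_eq_zero {n : ℕ} (hn : 1 ≤ n) {q ε : ℝ} (hq : 0 < q)
    (hε : 0 < ε) (hε' : ε ≤ 1 / 8) {y : Fin n → ℝ} (hnq : q ≤ ε * n)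
    (hmax : ∀ i, q * y i ^ 2 ≤ ε ^ 2 * n) (hS : 1 - ε ≤ (∑ i, y i ^ 2) / n)
    (hT : ((√n)⁻¹ * ∑ i, y i) ^ 2 ≤ q * ((1 - 2 * ε) / (1 + 16 * ε))) :
    ∃ w ∈ burgBall n (q / (2 * n)), ∑ i, y i * w i = 0 := by
  have hn' : (0 : ℝ) < n := by exact_mod_cast hn
  have hs2 : √(n : ℝ) ^ 2 = n := Real.sq_sqrt hn'.le
  set m := (∑ i, y i) / n with hm
  set V := (∑ i, y i ^ 2) / n - m ^ 2 with hV
  have hTm : ((√n)⁻¹ * ∑ i, y i) ^ 2 = n * m ^ 2 := by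
    rw [mul_pow, inv_pow, hs2, hm]; field_simp
  rw [hTm] at hT
  have hratio : (1 - 2 * ε) / (1 + 16 * ε) ≤ 1 := by rw [div_le_one (by linarith)]; linarith
  have hnm : n * m ^ 2 ≤ q := hT.trans (by nlinarith)
  have hm2 : m ^ 2 ≤ ε := by
    have : n * m ^ 2 ≤ n * ε := by linarith
    exact le_of_mul_le_mul_left this hn'
  have hVl : 1 - 2 * ε ≤ V := by linarith
  have hVpos : 0 < V := by linarith
  have hsumy : ∑ i, y i = n * m := by rw [hm]; field_simp
  have hcent : ∑ i, (y i - m) = 0 := by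
    rw [Finset.sum_sub_distrib, hsumy]; simp
  have hcent2 : ∑ i, (y i - m) ^ 2 = n * V := by
    have : ∀ i, (y i - m) ^ 2 = y i ^ 2 - 2 * m * y i + m ^ 2 := fun i => by ring
    rw [Finset.sum_congr rfl fun i _ => this i, Finset.sum_add_distrib, Finset.sum_sub_distrib,
      ← Finset.mul_sum, hsumy]
    have hd : (n : ℝ) * ((∑ i, y i ^ 2) / n) = ∑ i, y i ^ 2 := by field_simp
    rw [hV, mul_sub, hd]
    simp
    ring
  have hcenty : ∑ i, y i * (y i - m) = n * V := by
    rw [← hcent2]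
    have : ∀ i, y i * (y i - m) = (y i - m) ^ 2 + m * (y i - m) := fun i => by ring
    simp only [this, Finset.sum_add_distrib, ← Finset.mul_sum, hcent]
    simp
  set u : Fin n → ℝ := fun i => -(m / V * (y i - m)) with hu
  have hym : ∀ i, q * (y i - m) ^ 2 ≤ 4 * ε ^ 2 * n := by
    have hqm : q * m ^ 2 ≤ ε ^ 2 * n := by nlinarith [mul_nonneg hε.le hε.le]
    intro i
    nlinarith [hmax i, mul_nonneg hq.le (sq_nonneg (y i + m))]
  have huabs : ∀ i, |u i| ≤ 4 * ε := fun i => by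
    refine abs_le_of_sq_le_sq ?_ (by linarith)
    have h1 : n * m ^ 2 * (q * (y i - m) ^ 2) ≤ q * (4 * ε ^ 2 * n) :=
      mul_le_mul hnm (hym i) (by positivity) hq.le
    have h2 : m ^ 2 * (y i - m) ^ 2 ≤ 4 * ε ^ 2 := by
      have : (n * q) * (m ^ 2 * (y i - m) ^ 2) ≤ (n * q) * (4 * ε ^ 2) := by linarith
      exact le_of_mul_le_mul_left this (by positivity)
    have h3 : u i ^ 2 = m ^ 2 * (y i - m) ^ 2 / V ^ 2 := by rw [hu]; field_simp
    rw [h3, div_le_iff₀ (by positivity)]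
    have hV2 : 1 / 4 ≤ V ^ 2 := by nlinarith
    nlinarith [sq_nonneg ε]
  have hupos : ∀ i, 0 < 1 + u i := fun i => by have := (abs_le.1 (huabs i)).1; linarith
  have husum : ∑ i, u i = 0 := by
    simp only [hu, Finset.sum_neg_distrib, ← Finset.mul_sum, hcent]; simp
  have husq : ∑ i, u i ^ 2 = n * m ^ 2 / V := by
    simp only [hu, neg_sq, mul_pow, ← Finset.mul_sum, hcent2]; field_simp
  refine ⟨fun i => (n : ℝ)⁻¹ * (1 + u i), (mem_burgBall_iff hn).2 ⟨?_, ?_, fun i => ?_⟩, ?_⟩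
  · have hprod : ∏ i, (n * ((n : ℝ)⁻¹ * (1 + u i))) = ∏ i, (1 + u i) :=
      Finset.prod_congr rfl fun i _ => by field_simp
    rw [hprod, ← Real.le_log_iff_exp_le (Finset.prod_pos fun i _ => hupos i),
      Real.log_prod fun i _ => (hupos i).ne']
    have hη : (n : ℝ) * (q / (2 * n)) = q / 2 := by field_simp
    have hlow : ∑ i, (u i - (1 + 4 * (4 * ε)) / 2 * u i ^ 2) ≤ ∑ i, Real.log (1 + u i) :=
      Finset.sum_le_sum fun i _ => le_log_one_add_of_abs_le (huabs i) (by linarith)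
    rw [Finset.sum_sub_distrib, ← Finset.mul_sum, husum, husq] at hlow
    rw [hη]
    refine le_trans ?_ hlow
    have : (1 + 16 * ε) * (n * m ^ 2 / V) ≤ q := by
      rw [← mul_div_assoc, div_le_iff₀ hVpos]
      rw [← mul_div_assoc, le_div_iff₀ (by linarith)] at hT
      nlinarith
    linarith
  · rw [← Finset.mul_sum, Finset.sum_add_distrib, husum]
    simp [hn'.ne']
  · have := hupos i
    positivity
  · have : ∀ i, y i * ((n : ℝ)⁻¹ * (1 + u i))
        = (n : ℝ)⁻¹ * (y i - m / V * (y i * (y i - m))) := fun i => by rw [hu]; ring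
    simp only [this, ← Finset.mul_sum, Finset.sum_sub_distrib, hcenty, hsumy]
    field_simp
    ring

/-! ### Quantiles and the chi-square law. -/

theorem continuous_cdf_of_measure_singleton_eq_zero {μ : Measure ℝ} [IsProbabilityMeasure μ]
    (hμ : ∀ x, μ {x} = 0) : Continuous (cdf μ) := by
  refine continuous_iff_continuousAt.2 fun x => ?_
  have h : (cdf μ).measure {x} = 0 := by rw [measure_cdf, hμ]
  rw [StieltjesFunction.measure_singleton, ENNReal.ofReal_eq_zero] at h
  rw [continuousAt_iff_continuous_left_right]
  refine ⟨?_, (cdf μ).right_continuous x⟩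
  rw [← continuousWithinAt_Iio_iff_Iic, (monotone_cdf μ).continuousWithinAt_Iio_iff_leftLim_eq]
  exact le_antisymm ((monotone_cdf μ).leftLim_le le_rfl) (by linarith)

theorem quantile_set_bddBelow {μ : Measure ℝ} {p : ℝ} (hp : 0 < p) :
    BddBelow {t : ℝ | p ≤ cdf μ t} := by
  obtain ⟨a, ha⟩ := ((tendsto_cdf_atBot μ).eventually_lt_const hp).exists
  exact ⟨a, fun t ht => le_of_lt <| (monotone_cdf μ).reflect_lt (lt_of_lt_of_le ha ht)⟩

theorem cdf_quantile {μ : Measure ℝ} (hμ : Continuous (cdf μ)) {p : ℝ} (hp : 0 < p) (hp' : p < 1) :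
    cdf μ (quantile μ p) = p := by
  have hne : {t : ℝ | p ≤ cdf μ t}.Nonempty :=
    let ⟨a, ha⟩ := ((tendsto_cdf_atTop μ).eventually_const_lt hp').exists
    ⟨a, ha.le⟩
  have hmem : p ≤ cdf μ (quantile μ p) :=
    (isClosed_le continuous_const hμ).csInf_mem hne (quantile_set_bddBelow hp)
  refine le_antisymm ?_ hmem
  -- Below the infimum the cdf is less than `p`; take the limit from the left.
  refine le_of_tendsto (hμ.continuousWithinAt (s := Set.Iio (quantile μ p))) ?_
  filter_upwards [self_mem_nhdsWithin] with t ht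
  by_contra! hlt
  exact (notMem_of_lt_csInf ht (quantile_set_bddBelow hp)) hlt.le

instance : IsProbabilityMeasure chiSquareOne :=
  Measure.isProbabilityMeasure_map (by fun_prop)

theorem chiSquareOne_singleton (x : ℝ) : chiSquareOne {x} = 0 := by
  rw [chiSquareOne, Measure.map_apply (by fun_prop) (measurableSet_singleton x)]
  have := nullSingletonClass_gaussianReal (μ := 0) (v := 1) one_ne_zero
  refine Set.Finite.measure_zero ((Set.finite_singleton (√x)).union
    (Set.finite_singleton (-√x)) |>.subset fun z hz => ?_) _
  have hz : z ^ 2 = x := hz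
  rw [← hz, Real.sqrt_sq_eq_abs]
  rcases abs_choice z with h | h <;> rw [h] <;> simp

theorem continuous_cdf_chiSquareOne : Continuous (cdf chiSquareOne) :=
  continuous_cdf_of_measure_singleton_eq_zero chiSquareOne_singleton

theorem cdf_chiSquareOne_zero : cdf chiSquareOne 0 = 0 := by
  rw [cdf_eq_real, measureReal_def, chiSquareOne,
    Measure.map_apply (by fun_prop) measurableSet_Iic]
  have := nullSingletonClass_gaussianReal (μ := 0) (v := 1) one_ne_zero
  have : (fun z : ℝ => z ^ 2) ⁻¹' Set.Iic 0 = {0} := by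
    ext z
    simp
  simp [this]

theorem quantile_chiSquareOne_pos {p : ℝ} (hp : 0 < p) (hp' : p < 1) :
    0 < quantile chiSquareOne p := by
  refine (monotone_cdf chiSquareOne).reflect_lt ?_
  rwa [cdf_chiSquareOne_zero, cdf_quantile continuous_cdf_chiSquareOne hp hp']

/-! ### Limit theorems and the coverage probability. -/

section Probability

variable {Ω : Type*} [MeasurableSpace Ω] {P : Measure Ω} [IsProbabilityMeasure P]

/-- Convergence of indicators gives convergence of measures; measurable hulls, which agree a.e. with
the sets for all `n` at once, supply measurability. -/
theorem tendsto_measureReal_zero_of_ae_eventually_notMem {B : ℕ → Set Ω}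
    (hB : ∀ n, NullMeasurableSet (B n) P) (h : ∀ᵐ ω ∂P, ∀ᶠ n in atTop, ω ∉ B n) :
    Tendsto (fun n => P.real (B n)) atTop (𝓝 0) := by
  have hae : ∀ᵐ ω ∂P, ∀ n, ω ∈ toMeasurable P (B n) ↔ ω ∈ B n :=
    ae_all_iff.2 fun n => (hB n).toMeasurable_ae_eq.mem_iff
  have hlim := tendsto_measure_of_ae_tendsto_indicator_of_isFiniteMeasure (μ := P) atTop
    (As := fun n => toMeasurable P (B n)) MeasurableSet.empty
    (fun n => measurableSet_toMeasurable P (B n)) (by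
      filter_upwards [hae, h] with ω h1 h2
      filter_upwards [h2] with n hn
      simp [h1, hn])
  simp only [measure_toMeasurable, measure_empty] at hlim
  exact (ENNReal.tendsto_toReal ENNReal.zero_ne_top).comp hlim

/-- Differencing consecutive averages gives `a n / n → 0`. Late terms then satisfy `a i ≤ c * i ≤ c
* n`, and the finitely many early ones are bounded. -/
theorem eventually_forall_lt_le_mul_of_tendsto_average {a : ℕ → ℝ} {l c : ℝ} (hc : 0 < c)
    (h : Tendsto (fun n : ℕ => (∑ i ∈ Finset.range n, a i) / n) atTop (𝓝 l)) :
    ∀ᶠ n : ℕ in atTop, ∀ i < n, a i ≤ c * n := by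
  have hdiv : Tendsto (fun n : ℕ => a n / n) atTop (𝓝 0) := by
    have h1 : Tendsto (fun n : ℕ => ((n : ℝ) + 1) / n) atTop (𝓝 1) := by
      have : Tendsto (fun n : ℕ => 1 + 1 / (n : ℝ)) atTop (𝓝 (1 + 0)) :=
        tendsto_const_nhds.add tendsto_one_div_atTop_nhds_zero_nat
      rw [add_zero] at this
      refine this.congr' ?_
      filter_upwards [eventually_ne_atTop 0] with n hn
      field_simp
    have h2 := ((h.comp (tendsto_add_atTop_nat 1)).mul h1).sub h
    rw [mul_one, sub_self] at h2
    refine h2.congr' ?_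
    filter_upwards [eventually_ne_atTop 0] with n hn
    simp only [Function.comp, Finset.sum_range_succ, Nat.cast_add, Nat.cast_one]
    field_simp
    ring
  obtain ⟨N, hN⟩ := eventually_atTop.1 (hdiv.eventually_le_const hc)
  obtain ⟨M, hM⟩ := ((Finset.range (N + 1)).image a).bddAbove
  have hlarge : ∀ᶠ n : ℕ in atTop, M ≤ c * n :=
    (tendsto_natCast_atTop_atTop.const_mul_atTop hc).eventually_ge_atTop M
  filter_upwards [hlarge] with n hn i hi
  rcases le_or_gt i N with hiN | hiN
  · exact (hM (by simpa using ⟨i, by omega, rfl⟩)).trans hn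
  · have hi0 : (0 : ℝ) < i := by exact_mod_cast (by omega : 0 < i)
    have h1 := hN i hiN.le
    rw [div_le_iff₀ hi0] at h1
    have : (i : ℝ) ≤ n := by exact_mod_cast hi.le
    exact h1.trans (by gcongr)

/-- CLT, continuous mapping by squaring, then portmanteau: the frontier `{r}` is `χ²`-null. -/
theorem tendsto_measureReal_sq_normalized_sum_le {Y : ℕ → Ω → ℝ} (hindep : iIndepFun Y P)
    (hident : ∀ i, IdentDistrib (Y i) (Y 0) P P) (h0 : P[Y 0] = 0) (h1 : P[Y 0 ^ 2] = 1) (r : ℝ) :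
    Tendsto (fun n : ℕ => P.real {ω | ((√n)⁻¹ * ∑ k ∈ Finset.range n, Y k ω) ^ 2 ≤ r}) atTop
      (𝓝 (cdf chiSquareOne r)) := by
  have hlim := (tendstoInDistribution_inv_sqrt_mul_sum (Y := fun z : ℝ => z)
    (P' := gaussianReal 0 1) ⟨by fun_prop, Measure.map_id⟩ h0 h1 hindep hident).continuous_comp
    (g := fun z : ℝ => z ^ 2) (by fun_prop)
  have hport := ProbabilityMeasure.tendsto_measure_of_null_frontier_of_tendsto' hlim.tendsto
    (E := Set.Iic r) (by
      rw [frontier_Iic]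
      exact chiSquareOne_singleton r)
  have hreal : Tendsto _ atTop (𝓝 (chiSquareOne (Set.Iic r)).toReal) :=
    (ENNReal.tendsto_toReal (measure_ne_top chiSquareOne _)).comp hport
  rw [cdf_eq_real]
  refine hreal.congr fun n => ?_
  simp only [Function.comp, ProbabilityMeasure.coe_mk, measureReal_def]
  rw [Measure.map_apply_of_aemeasurable (hlim.forall_aemeasurable n) measurableSet_Iic]
  rfl

/-- The coverage probability of empirical likelihood for a standardized i.i.d. sequence. -/
theorem tendsto_measureReal_exists_mem_burgBall {Y : ℕ → Ω → ℝ} (hindep : iIndepFun Y P)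
    (hident : ∀ i, IdentDistrib (Y i) (Y 0) P P) (h0 : P[Y 0] = 0) (h1 : P[Y 0 ^ 2] = 1)
    {q : ℝ} (hq : 0 < q) :
    Tendsto (fun n : ℕ => P.real {ω |
        (∃ w ∈ burgBall n (q / (2 * n)), ∑ i : Fin n, Y i ω * w i ≤ 0) ∧
        ∃ w ∈ burgBall n (q / (2 * n)), 0 ≤ ∑ i : Fin n, Y i ω * w i}) atTop
      (𝓝 (cdf chiSquareOne q)) := by
  -- Measurability of `A n` is never needed: only monotonicity and subadditivity are applied to it.
  set A : ℕ → Set Ω := fun n => {ω |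
        (∃ w ∈ burgBall n (q / (2 * n)), ∑ i : Fin n, Y i ω * w i ≤ 0) ∧
        ∃ w ∈ burgBall n (q / (2 * n)), 0 ≤ ∑ i : Fin n, Y i ω * w i} with hA
  set S : ℝ → ℕ → Set Ω := fun r n => {ω | ((√n)⁻¹ * ∑ k ∈ Finset.range n, Y k ω) ^ 2 ≤ r} with hS
  have hlimS : ∀ r, Tendsto (fun n => P.real (S r n)) atTop (𝓝 (cdf chiSquareOne r)) :=
    tendsto_measureReal_sq_normalized_sum_le hindep hident h0 h1
  have hYm : ∀ i, AEMeasurable (Y i) P := fun i => (hident i).aemeasurable_fst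
  set B : ℝ → ℕ → Set Ω := fun ε n => {ω | ¬ (|(∑ k ∈ Finset.range n, Y k ω ^ 2) / n - 1| ≤ ε ∧
    ∀ i < n, q * Y i ω ^ 2 ≤ ε ^ 2 * n)} with hB
  -- A non-integrable function would have integral `0` by convention, not `1`.
  have hint : Integrable (Y 0 ^ 2) P := by
    by_contra h
    rw [integral_undef h] at h1
    exact zero_ne_one h1
  have hslln : ∀ᵐ ω ∂P, Tendsto (fun n : ℕ => (∑ k ∈ Finset.range n, Y k ω ^ 2) / n) atTop (𝓝 1) := by
    have := strong_law_ae_real (fun i ω => Y i ω ^ 2) hint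
      (fun i j hij => (hindep.indepFun hij).comp (measurable_id.pow_const 2)
        (measurable_id.pow_const 2))
      (fun i => (hident i).comp (u := fun z => z ^ 2) (by fun_prop))
    rw [← h1]
    exact this
  have hlimB : ∀ ε > 0, Tendsto (fun n => P.real (B ε n)) atTop (𝓝 0) := by
    intro ε hε
    refine tendsto_measureReal_zero_of_ae_eventually_notMem (fun n => ?_) ?_
    · have hset : B ε n = ({ω | |(∑ k ∈ Finset.range n, Y k ω ^ 2) / n - 1| ≤ ε} ∩
          ⋂ i : Fin n, {ω | q * Y i ω ^ 2 ≤ ε ^ 2 * n})ᶜ := by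
        ext ω
        simp [hB, Fin.forall_iff]
      rw [hset]
      refine NullMeasurableSet.compl (NullMeasurableSet.inter ?_ (NullMeasurableSet.iInter fun i => ?_))
      · exact nullMeasurableSet_le (by fun_prop) (by fun_prop)
      · exact nullMeasurableSet_le (by fun_prop) (by fun_prop)
    · filter_upwards [hslln] with ω hω
      have e1 : ∀ᶠ n : ℕ in atTop, |(∑ k ∈ Finset.range n, Y k ω ^ 2) / n - 1| ≤ ε := by
        filter_upwards [Metric.tendsto_nhds.1 hω ε hε] with n hn
        exact (Real.dist_eq _ _ ▸ hn).le
      filter_upwards [e1, eventually_forall_lt_le_mul_of_tendsto_average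
        (c := ε ^ 2 / q) (by positivity) hω] with n hn1 hn2
      refine not_not.2 ⟨hn1, fun i hi => ?_⟩
      have := mul_le_mul_of_nonneg_left (hn2 i hi) hq.le
      calc q * Y i ω ^ 2 ≤ q * (ε ^ 2 / q * n) := this
        _ = ε ^ 2 * n := by field_simp
  have hfin : ∀ (f : ℝ → ℝ) (n : ℕ) (ω : Ω),
      ∑ i : Fin n, f (Y i ω) = ∑ k ∈ Finset.range n, f (Y k ω) := fun f n ω =>
    Fin.sum_univ_eq_sum_range (fun k => f (Y k ω)) n
  have hupper : ∀ ε > 0, ε ≤ 1 / 8 → ∀ n ≥ 1, A n ⊆ S (q * (1 + 5 * ε) ^ 2) n ∪ B ε n := by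
    intro ε hε hε' n hn ω hω
    refine or_iff_not_imp_right.2 fun hb => ?_
    obtain ⟨hb1, hb2⟩ := not_not.1 hb
    have := sq_normalized_sum_le_of_mem_burgBall hn hq hε (by linarith) (y := fun i => Y i ω)
      (fun i => hb2 i i.2) (by rw [hfin fun x => x ^ 2]; linarith [(abs_le.1 hb1).2]) hω.1 hω.2
    rwa [hfin fun x => x] at this
  have hlower : ∀ ε > 0, ε ≤ 1 / 8 → ∀ᶠ n : ℕ in atTop,
      S (q * ((1 - 2 * ε) / (1 + 16 * ε))) n ⊆ A n ∪ B ε n := by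
    intro ε hε hε'
    filter_upwards [eventually_ge_atTop 1,
      (tendsto_natCast_atTop_atTop.const_mul_atTop hε).eventually_ge_atTop q] with n hn hnq ω hω
    refine or_iff_not_imp_right.2 fun hb => ?_
    obtain ⟨hb1, hb2⟩ := not_not.1 hb
    obtain ⟨w, hw, hw0⟩ := exists_mem_burgBall_sum_eq_zero hn hq hε hε' (y := fun i => Y i ω)
      hnq (fun i => hb2 i i.2) (by rw [hfin fun x => x ^ 2]; linarith [(abs_le.1 hb1).1])
      (by rw [hfin fun x => x]; exact hω)
    exact ⟨⟨w, hw, hw0.le⟩, ⟨w, hw, hw0.ge⟩⟩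
  have hcont := continuous_cdf_chiSquareOne
  have hsmall : ∀ᶠ ε : ℝ in 𝓝[>] 0, 0 < ε ∧ ε ≤ 1 / 8 := by
    filter_upwards [Ioc_mem_nhdsGT (by norm_num : (0 : ℝ) < 1 / 8)] with ε hε using hε
  -- For each strict bound `a`, first fix `ε` by continuity of the cdf, then let `n → ∞`.
  refine tendsto_order.2 ⟨fun a ha => ?_, fun a ha => ?_⟩
  · have hε : Tendsto (fun ε : ℝ => cdf chiSquareOne (q * ((1 - 2 * ε) / (1 + 16 * ε))))
        (𝓝[>] 0) (𝓝 (cdf chiSquareOne q)) := by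
      have : ContinuousAt (fun ε : ℝ => cdf chiSquareOne (q * ((1 - 2 * ε) / (1 + 16 * ε)))) 0 :=
        hcont.continuousAt.comp (by fun_prop (disch := norm_num))
      have h := this.tendsto
      simp only [mul_zero, sub_zero, add_zero, div_one, mul_one] at h
      exact h.mono_left nhdsWithin_le_nhds
    obtain ⟨ε, hεa, hε0, hε8⟩ := ((hε.eventually_const_lt ha).and hsmall).exists
    have hl := (hlimS (q * ((1 - 2 * ε) / (1 + 16 * ε)))).sub (hlimB ε hε0)
    rw [sub_zero] at hl
    filter_upwards [hl.eventually_const_lt hεa, hlower ε hε0 hε8] with n hn hsub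
    have := (measureReal_mono hsub (measure_ne_top P _)).trans (measureReal_union_le _ _)
    linarith
  · have hε : Tendsto (fun ε : ℝ => cdf chiSquareOne (q * (1 + 5 * ε) ^ 2))
        (𝓝[>] 0) (𝓝 (cdf chiSquareOne q)) := by
      have : ContinuousAt (fun ε : ℝ => cdf chiSquareOne (q * (1 + 5 * ε) ^ 2)) 0 :=
        hcont.continuousAt.comp (by fun_prop)
      have h := this.tendsto
      simp only [mul_zero, add_zero, one_pow, mul_one] at h
      exact h.mono_left nhdsWithin_le_nhds
    obtain ⟨ε, hεa, hε0, hε8⟩ := ((hε.eventually_lt_const ha).and hsmall).exists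
    have hl := (hlimS (q * (1 + 5 * ε) ^ 2)).add (hlimB ε hε0)
    rw [add_zero] at hl
    filter_upwards [hl.eventually_lt_const hεa, eventually_ge_atTop 1] with n hn hn1
    have := (measureReal_mono (hupper ε hε0 hε8 n hn1) (measure_ne_top P _)).trans
      (measureReal_union_le _ _)
    linarith

end Probability

/-! ### Reduction of the theorem to the standardized sequence. -/

theorem minValue_le_iff {n : ℕ} (hn : 1 ≤ n) {η c : ℝ} (hη : 0 ≤ η) (y : Fin n → ℝ) :
    minValue η y ≤ c ↔ ∃ w ∈ burgBall n η, ∑ i, y i * w i ≤ c := by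
  have hmin := isLeast_minValue hn hη y
  constructor
  · intro h
    obtain ⟨w, hw, hwy⟩ := hmin.1
    exact ⟨w, hw, hwy.trans_le h⟩
  · rintro ⟨w, hw, hwy⟩
    exact (hmin.2 ⟨w, hw, rfl⟩).trans hwy

theorem le_maxValue_iff {n : ℕ} (hn : 1 ≤ n) {η c : ℝ} (hη : 0 ≤ η) (y : Fin n → ℝ) :
    c ≤ maxValue η y ↔ ∃ w ∈ burgBall n η, c ≤ ∑ i, y i * w i := by
  have hmax := isGreatest_maxValue hn hη y
  constructor
  · intro h
    obtain ⟨w, hw, hwy⟩ := hmax.1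
    exact ⟨w, hw, h.trans_eq hwy.symm⟩
  · rintro ⟨w, hw, hwy⟩
    exact hwy.trans (hmax.2 ⟨w, hw, rfl⟩)

theorem sum_standardized_mul_eq {n : ℕ} {w : Fin n → ℝ} (hw : ∑ i, w i = 1) (y : Fin n → ℝ)
    (c s : ℝ) : ∑ i, (y i - c) / s * w i = (∑ i, y i * w i - c) / s := by
  calc ∑ i, (y i - c) / s * w i = ∑ i, (y i * w i - c * w i) / s :=
        Finset.sum_congr rfl fun i _ => by ring
    _ = (∑ i, y i * w i - c) / s := by
        rw [← Finset.sum_div, Finset.sum_sub_distrib, ← Finset.mul_sum, hw, mul_one]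

/-- The first two conjuncts say that the minimum and the maximum exist, for every sample; the
third is the asymptotically exact coverage. -/
theorem mainTheorem3 {m : ℕ} (Θ : Set (EuclideanSpace ℝ (Fin m)))
    {Ξ : Type*} [MeasurableSpace Ξ] (P₀ : Measure Ξ) [IsProbabilityMeasure P₀]
    (h : Θ → Ξ → ℝ)
    {Ω : Type*} [MeasurableSpace Ω] (P : Measure Ω) [IsProbabilityMeasure P]
    (ξ : ℕ → Ω → Ξ) (hlaw : ∀ i, HasLaw (ξ i) P₀ P) (hindep : iIndepFun ξ P)
    (α : ℝ) (hα₀ : 0 < α) (hα₁ : α < 1)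
    (x : Θ)
    (hmean : Integrable (h x) P₀)
    (hvar_pos : 0 < evariance (h x) P₀) (hvar_fin : evariance (h x) P₀ < ⊤) :
    (∀ n : ℕ, 1 ≤ n → ∀ ω : Ω,
      IsLeast (objectiveValues (burgRadius α n) (fun i : Fin n => h x (ξ i ω)))
        (minValue (burgRadius α n) (fun i : Fin n => h x (ξ i ω)))) ∧
    (∀ n : ℕ, 1 ≤ n → ∀ ω : Ω,
      IsGreatest (objectiveValues (burgRadius α n) (fun i : Fin n => h x (ξ i ω)))
        (maxValue (burgRadius α n) (fun i : Fin n => h x (ξ i ω)))) ∧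
    Tendsto
      (fun n : ℕ => P.real {ω |
        minValue (burgRadius α n) (fun i : Fin n => h x (ξ i ω)) ≤ ∫ s, h x s ∂P₀ ∧
        ∫ s, h x s ∂P₀ ≤ maxValue (burgRadius α n) (fun i : Fin n => h x (ξ i ω))})
      atTop (𝓝 (1 - α)) := by
  have hp : 0 < 1 - α := by linarith
  have hp' : 1 - α < 1 := by linarith
  have hq := quantile_chiSquareOne_pos hp hp'
  have hη : ∀ n, 0 ≤ burgRadius α n := fun n => div_nonneg hq.le (by positivity)
  refine ⟨fun n hn ω => isLeast_minValue hn (hη n) _,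
    fun n hn ω => isGreatest_maxValue hn (hη n) _, ?_⟩
  set c := ∫ s, h x s ∂P₀ with hc
  have hv : 0 < variance (h x) P₀ := ENNReal.toReal_pos hvar_pos.ne' hvar_fin.ne
  set s := √(variance (h x) P₀) with hs
  have hs0 : 0 < s := Real.sqrt_pos.2 hv
  have hs2 : s ^ 2 = variance (h x) P₀ := Real.sq_sqrt hv.le
  set g : Ξ → ℝ := fun z => (h x z - c) / s with hg
  have hgm : AEMeasurable g P₀ := (hmean.aemeasurable.sub_const c).div_const s
  set Y : ℕ → Ω → ℝ := fun i => g ∘ ξ i with hY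
  have hindepY : iIndepFun Y P :=
    hindep.comp₀ (fun _ => g) (fun i => (hlaw i).aemeasurable)
      (fun i => by rw [(hlaw i).map_eq]; exact hgm)
  have hident : ∀ i, IdentDistrib (Y i) (Y 0) P P := fun i =>
    ((hlaw i).identDistrib (hlaw 0)).comp_of_aemeasurable (by rw [(hlaw i).map_eq]; exact hgm)
  have h0 : P[Y 0] = 0 := by
    rw [hY, (hlaw 0).integral_comp hgm.aestronglyMeasurable, hg, integral_div,
      integral_sub hmean (integrable_const c)]
    simp [hc]
  have h1 : P[Y 0 ^ 2] = 1 := by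
    have : (Y 0 ^ 2 : Ω → ℝ) = (fun z => g z ^ 2) ∘ ξ 0 := rfl
    rw [this, (hlaw 0).integral_comp (hgm.pow_const 2).aestronglyMeasurable]
    simp only [hg, div_pow]
    rw [integral_div, ← variance_eq_integral hmean.aemeasurable, hs2, div_self hv.ne']
  have hlim := tendsto_measureReal_exists_mem_burgBall hindepY hident h0 h1 hq
  rw [cdf_quantile continuous_cdf_chiSquareOne hp hp'] at hlim
  refine hlim.congr' ?_
  filter_upwards [eventually_ge_atTop 1] with n hn
  congr 1
  ext ω
  -- Weights sum to one, so standardizing commutes with weighting, and comparison with `c` becomes a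
  -- sign condition.
  have hsum : ∀ w ∈ burgBall n (burgRadius α n),
      ∑ i : Fin n, Y i ω * w i = (∑ i : Fin n, h x (ξ i ω) * w i - c) / s := fun w hw =>
    sum_standardized_mul_eq hw.2.1 (fun i : Fin n => h x (ξ i ω)) c s
  refine and_congr ?_ ?_
  · rw [minValue_le_iff hn (hη n)]
    refine exists_congr fun w => and_congr_right fun hw => ?_
    rw [hsum w hw, div_le_iff₀ hs0, zero_mul, sub_nonpos]
  · rw [le_maxValue_iff hn (hη n)]
    refine exists_congr fun w => and_congr_right fun hw => ?_
    rw [hsum w hw, le_div_iff₀ hs0, zero_mul, sub_nonneg]
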